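/- Let $N\ge 1$ be an integer, $\alpha\in(0,2]$ and $p=1+\alpha/N$, and let $\Lambda^\alpha=(-\Delta)^{\alpha/2}$ be the operator on $\mathbb{R}^N$ with Fourier symbol $|\xi|^\alpha$. Let $u_0\in L^1(\mathbb{R}^N)$, $u_0\ge 0$, and consider the Cauchy problem $$\partial_t u=-\Lambda^\alpha u+u^p\quad (x\in\mathbb{R}^N,\ t>0),\qquad u(x,0)=u_0(x).$$ For $0<T\le\infty$, a nonnegative weak solution on $[0,T)$ is a measurable function $u\ge 0$ on $\mathbb{R}^N\times(0,T)$ such that, for every $\varphi\in C_c^\infty(\mathbb{R}^N\times[0,T))$, all the integrals in $$\int_0^T\!\!\int_{\mathbb{R}^N}u\,\Lambda^\alpha\varphi\,dx\,dt=\int_{\mathbb{R}^N}u_0(x)\varphi(x,0)\,dx+\int_0^T\!\!\int_{\mathbb{R}^N}u\,\partial_t\varphi\,dx\,dt+\int_0^T\!\!\int_{\mathbb{R}^N}u^p\varphi\,dx\,dt$$ converge absolutely and the identity holds. Then every nonnegative weak solution on $[0,T)$ that is nonzero (that is, does not vanish almost everywhere) has $T<\infty$. In other words, every nonnegative nonzero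 solution blows up in finite time: no nonnegative nontrivial solution is global. -/

import Mathlib

open MeasureTheory
open scoped FourierTransform ENNReal ContDiff

/-- The fractional Laplacian `Λ^α f = (-Δ)^{α/2} f` of a function `f` on `ℝ^N`, defined through the
Fourier transform. Mathlib's transform uses the character `exp (-2 π i ⟨y, ξ⟩)`, for which the
symbol `|ξ|^α` of the convention `exp (-i ⟨y, ξ⟩)` reads `(2 π |ξ|)^α`. -/
noncomputable def fracLaplacian {N : ℕ} (α : ℝ) (f : EuclideanSpace ℝ (Fin N) → ℝ)
    (x : EuclideanSpace ℝ (Fin N)) : ℝ :=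
  (𝓕⁻ (fun ξ : EuclideanSpace ℝ (Fin N) =>
    (((2 * Real.pi * ‖ξ‖) ^ α : ℝ) : ℂ) *
      𝓕 (fun y : EuclideanSpace ℝ (Fin N) => (f y : ℂ)) ξ) x).re

/-- The space-time slab `(0, T) × ℝ^N`, with `0 ≤ T ≤ ∞`; points are written `(t, x)`. -/
def slab (N : ℕ) (T : ℝ≥0∞) : Set (ℝ × EuclideanSpace ℝ (Fin N)) :=
  {z | 0 < z.1 ∧ ENNReal.ofReal z.1 < T}

/-- Test functions for the Cauchy problem on `[0, T) × ℝ^N`: smooth functions of `(t, x)` with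
compact support contained in `{t < T}`. They need not vanish at `t = 0`. -/
structure IsTestFunction {N : ℕ} (T : ℝ≥0∞) (φ : ℝ × EuclideanSpace ℝ (Fin N) → ℝ) : Prop where
  smooth : ContDiff ℝ ∞ φ
  compact : HasCompactSupport φ
  support : ∀ z ∈ tsupport φ, ENNReal.ofReal z.1 < T

/-- `u` is a weak solution on `[0, T) × ℝ^N`, `0 < T ≤ ∞`, of the Cauchy problem
`∂ₜ u = -Λ^α u + lam * u ^ p`, `u(0) = u₀`. For every test function all integrals in the weak
formulation are required to converge absolutely. -/
structure IsWeakSolution {N : ℕ} (α lam p : ℝ) (u₀ : EuclideanSpace ℝ (Fin N) → ℝ) (T : ℝ≥0∞)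
    (u : ℝ × EuclideanSpace ℝ (Fin N) → ℝ) : Prop where
  pos : 0 < T
  aestronglyMeasurable : AEStronglyMeasurable u (volume.restrict (slab N T))
  integrable_pow : ∀ φ, IsTestFunction T φ →
    IntegrableOn (fun z => u z ^ p * φ z) (slab N T)
  integrable_time : ∀ φ, IsTestFunction T φ →
    IntegrableOn (fun z => u z * deriv (fun s : ℝ => φ (s, z.2)) z.1) (slab N T)
  integrable_space : ∀ φ, IsTestFunction T φ →
    IntegrableOn (fun z => u z * fracLaplacian α (fun y => φ (z.1, y)) z.2) (slab N T)
  weak_eq : ∀ φ, IsTestFunction T φ →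
    ∫ z in slab N T, u z * fracLaplacian α (fun y => φ (z.1, y)) z.2 =
      (∫ x, u₀ x * φ (0, x))
        + (∫ z in slab N T, u z * deriv (fun s : ℝ => φ (s, z.2)) z.1)
        + lam * ∫ z in slab N T, u z ^ p * φ z

/-! The proof is the test function method at the critical exponent. A global solution is tested
against `θ ^ (l + 1)`, where `θ` is a cut-off at time scale `τ` and space scale `R`. The datum
contributes with a favourable sign. The Córdoba–Córdoba inequality `fracLaplacian_pow_le` bounds the
diffusion term by a multiple of `R ^ (-α) * θ ^ l`, and the time derivative is at most a multiple of
`τ⁻¹ * θ ^ l`, living on `t ≥ τ`. Young's inequality then bounds `∫ u ^ p * φ` by small multiples of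
itself plus volume terms.

With `τ = δ * R ^ α` and `α * q = N + α`, all powers of `R` cancel (`exists_critical_estimate`).
Hence `u ^ p` is integrable over the whole slab, so its integral over `t ≥ τ` vanishes as `R → ∞`.
That tail may therefore carry an arbitrarily large weight `A`; `A → ∞` removes the cost of the time
derivative and leaves `∫ u ^ p ≤ D * δ`, and `δ → 0` gives `u = 0`.

Córdoba–Córdoba rests on the maximum principle for `Λ^α`. By Bernstein's formula `r ^ α` is a
positive mixture of the symbols `1 - exp (-s r ^ 2)`, each being the identity minus an average
against a Gaussian probability density, hence nonpositive at a global minimum. -/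

/-! ### Bernstein's integral formula for fractional powers. -/

lemma integrableOn_rpow_mul_one_sub_exp {a : ℝ} (ha₀ : 0 < a) (ha₁ : a < 1) :
    IntegrableOn (fun s : ℝ => s ^ (-1 - a) * (1 - Real.exp (-s))) (Set.Ioi 0) := by
  have hm : ∀ t : Set ℝ, AEStronglyMeasurable (fun s : ℝ => s ^ (-1 - a) * (1 - Real.exp (-s)))
      (volume.restrict t) := fun t => by
    apply Measurable.aestronglyMeasurable
    fun_prop
  -- Integrability at `0` uses `1 - exp (-s) ≤ s` and `a < 1`; at infinity it uses `a > 0`.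
  rw [← Set.Ioc_union_Ioi_eq_Ioi (zero_le_one : (0:ℝ) ≤ 1)]
  refine IntegrableOn.union ?_ ?_
  · have h : IntegrableOn (fun s : ℝ => s ^ (-a)) (Set.Ioc 0 1) := by
      have := intervalIntegral.intervalIntegrable_rpow' (a := 0) (b := 1) (r := -a) (by linarith)
      rwa [intervalIntegrable_iff_integrableOn_Ioc_of_le zero_le_one] at this
    refine Integrable.mono' h (hm _) ((ae_restrict_iff' measurableSet_Ioc).2 (.of_forall ?_))
    intro s hs
    have hs0 : 0 < s := hs.1
    have h1 : 0 ≤ 1 - Real.exp (-s) := by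
      have := Real.exp_le_one_iff.2 (neg_nonpos.2 hs0.le); linarith
    have h2 : 1 - Real.exp (-s) ≤ s := by linarith [Real.add_one_le_exp (-s)]
    rw [Real.norm_of_nonneg (by positivity)]
    calc _ ≤ s ^ (-1 - a) * s := by gcongr
      _ = s ^ (-a) := by
        rw [← Real.rpow_add_one hs0.ne']; congr 1; ring
  · have h : IntegrableOn (fun s : ℝ => s ^ (-1 - a)) (Set.Ioi 1) :=
      integrableOn_Ioi_rpow_of_lt (by linarith) zero_lt_one
    refine Integrable.mono' h (hm _) ((ae_restrict_iff' measurableSet_Ioi).2 (.of_forall ?_))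
    intro s hs
    have hs0 : 0 < s := zero_lt_one.trans hs
    have h1 : 0 ≤ 1 - Real.exp (-s) := by
      have := Real.exp_le_one_iff.2 (neg_nonpos.2 hs0.le); linarith
    have h2 : 1 - Real.exp (-s) ≤ 1 := by linarith [Real.exp_pos (-s)]
    rw [Real.norm_of_nonneg (by positivity)]
    exact mul_le_of_le_one_right (by positivity) h2

lemma integral_rpow_mul_one_sub_exp_pos {a : ℝ} (ha₀ : 0 < a) (ha₁ : a < 1) :
    0 < ∫ s in Set.Ioi (0 : ℝ), s ^ (-1 - a) * (1 - Real.exp (-s)) := by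
  have hpos : ∀ s ∈ Set.Ioi (0 : ℝ), 0 < s ^ (-1 - a) * (1 - Real.exp (-s)) := by
    intro s hs
    have hs0 : 0 < s := hs
    have h1 : Real.exp (-s) < 1 := by simpa using hs0
    exact mul_pos (by positivity) (by linarith)
  rw [setIntegral_pos_iff_support_of_nonneg_ae
    ((ae_restrict_iff' measurableSet_Ioi).2 (.of_forall fun s hs => (hpos s hs).le))
    (integrableOn_rpow_mul_one_sub_exp ha₀ ha₁)]
  have hsub : Set.Ioi (0 : ℝ) ⊆
      Function.support (fun s : ℝ => s ^ (-1 - a) * (1 - Real.exp (-s))) ∩ Set.Ioi 0 :=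
    fun s hs => ⟨(hpos s hs).ne', hs⟩
  exact lt_of_lt_of_le (by simp) (measure_mono hsub)

lemma rpow_mul_one_sub_exp_mul_eq {a b s : ℝ} (hb : 0 < b) (hs : 0 < s) :
    s ^ (-1 - a) * (1 - Real.exp (-(s * b))) =
      b ^ (1 + a) * ((b * s) ^ (-1 - a) * (1 - Real.exp (-(b * s)))) := by
  rw [Real.mul_rpow hb.le hs.le, mul_comm s b, ← mul_assoc, ← mul_assoc, ← Real.rpow_add hb]
  simp

lemma integrableOn_rpow_mul_one_sub_exp_mul {a b : ℝ} (ha₀ : 0 < a) (ha₁ : a < 1) (hb : 0 ≤ b) :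
    IntegrableOn (fun s : ℝ => s ^ (-1 - a) * (1 - Real.exp (-(s * b)))) (Set.Ioi 0) := by
  rcases hb.eq_or_lt with rfl | hb
  · simp
  refine (integrableOn_congr_fun (fun s hs => rpow_mul_one_sub_exp_mul_eq (a := a) hb hs)
    measurableSet_Ioi).2 ?_
  refine Integrable.const_mul ?_ _
  have := (integrableOn_Ioi_comp_mul_left_iff
    (fun s : ℝ => s ^ (-1 - a) * (1 - Real.exp (-s))) 0 hb).2
    (by simpa using integrableOn_rpow_mul_one_sub_exp ha₀ ha₁)
  exact this

lemma setIntegral_rpow_mul_one_sub_exp_mul {a b : ℝ} (ha₀ : 0 < a) (hb : 0 ≤ b) :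
    ∫ s in Set.Ioi (0 : ℝ), s ^ (-1 - a) * (1 - Real.exp (-(s * b))) =
      b ^ a * ∫ s in Set.Ioi (0 : ℝ), s ^ (-1 - a) * (1 - Real.exp (-s)) := by
  rcases hb.eq_or_lt with rfl | hb
  · simp [Real.zero_rpow ha₀.ne']
  rw [setIntegral_congr_fun measurableSet_Ioi fun s hs => rpow_mul_one_sub_exp_mul_eq hb hs,
    integral_const_mul,
    integral_comp_mul_left_Ioi (fun s : ℝ => s ^ (-1 - a) * (1 - Real.exp (-s))) 0 hb]
  rw [mul_zero, smul_eq_mul, ← mul_assoc, add_comm, Real.rpow_add_one hb.ne', mul_assoc (b ^ a),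
    mul_inv_cancel₀ hb.ne', mul_one]

/-- Bernstein subordination: if a function integrates to a nonpositive number against the symbols
`1 - exp (-s r ^ 2)`, then it also does so against `r ^ α` for `0 < α ≤ 2`. -/
lemma integral_rpow_mul_nonpos {X : Type*} [MeasurableSpace X] {μ : Measure X} [SFinite μ]
    {α : ℝ} (hα₀ : 0 < α) (hα₂ : α ≤ 2) {r g : X → ℝ} (hr : Measurable r) (hr₀ : ∀ x, 0 ≤ r x)
    (hg : AEStronglyMeasurable g μ) (hrg : Integrable (fun x => r x ^ α * g x) μ)
    (h : ∀ s > 0, ∫ x, (1 - Real.exp (-(s * r x ^ 2))) * g x ∂μ ≤ 0) :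
    ∫ x, r x ^ α * g x ∂μ ≤ 0 := by
  have hbd : ∀ s > 0, ∀ x, 0 ≤ 1 - Real.exp (-(s * r x ^ 2)) := fun s hs x => by
    have : Real.exp (-(s * r x ^ 2)) ≤ 1 :=
      Real.exp_le_one_iff.2 (by simp only [neg_nonpos]; positivity)
    linarith
  rcases hα₂.eq_or_lt with rfl | hα
  -- For `α = 2` the Bernstein integral diverges; instead `r ^ 2` is the derivative of `1 - exp (-s
  -- r ^ 2)` at `s = 0`.
  · have hlim : Filter.Tendsto (fun s : ℝ => ∫ x, s⁻¹ * (1 - Real.exp (-(s * r x ^ 2))) * g x ∂μ)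
        (nhdsWithin 0 (Set.Ioi 0)) (nhds (∫ x, r x ^ (2:ℝ) * g x ∂μ)) := by
      refine tendsto_integral_filter_of_dominated_convergence (fun x => ‖r x ^ (2:ℝ) * g x‖)
        (.of_forall fun s => ?_) ?_ hrg.norm (.of_forall fun x => ?_)
      · exact (Measurable.aestronglyMeasurable (by fun_prop)).mul hg
      · filter_upwards [self_mem_nhdsWithin] with s hs
        refine .of_forall fun x => ?_
        have hs : 0 < s := hs
        rw [norm_mul, norm_mul (r x ^ (2:ℝ))]
        refine mul_le_mul_of_nonneg_right ?_ (norm_nonneg _)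
        rw [Real.norm_of_nonneg (mul_nonneg (by positivity) (hbd s hs x)),
          Real.norm_of_nonneg (by have := hr₀ x; positivity), inv_mul_le_iff₀ hs, Real.rpow_two]
        linarith [Real.add_one_le_exp (-(s * r x ^ 2))]
      · refine Filter.Tendsto.mul_const _ ?_
        have hd : HasDerivAt (fun s : ℝ => 1 - Real.exp (-(s * r x ^ 2))) (r x ^ 2) 0 := by
          have := (((hasDerivAt_id (0:ℝ)).mul_const (r x ^ 2)).neg.exp).const_sub 1
          simpa using this
        have := hd.tendsto_slope_zero_right
        simpa [Real.rpow_two] using this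
    refine le_of_tendsto hlim ?_
    filter_upwards [self_mem_nhdsWithin] with s hs
    have hs : 0 < s := hs
    simp only [mul_assoc, integral_const_mul]
    exact mul_nonpos_of_nonneg_of_nonpos (by positivity) (h s hs)
  · set a := α / 2
    have ha₀ : 0 < a := by positivity
    have ha₁ : a < 1 := by simp only [a]; linarith
    set κ := ∫ s in Set.Ioi (0 : ℝ), s ^ (-1 - a) * (1 - Real.exp (-s))
    have hκ : 0 < κ := integral_rpow_mul_one_sub_exp_pos ha₀ ha₁
    have hra : ∀ x, (r x ^ 2) ^ a = r x ^ α := fun x => by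
      rw [← Real.rpow_natCast, ← Real.rpow_mul (hr₀ x)]
      congr 1; simp [a]; ring
    -- Joint integrability for Fubini: integrating the norm in `s` first returns `κ * ‖r ^ α * g‖`.
    have hint : Integrable (fun z : ℝ × X =>
        z.1 ^ (-1 - a) * (1 - Real.exp (-(z.1 * r z.2 ^ 2))) * g z.2)
        ((volume.restrict (Set.Ioi 0)).prod μ) := by
      have hmeas : AEStronglyMeasurable (fun z : ℝ × X =>
          z.1 ^ (-1 - a) * (1 - Real.exp (-(z.1 * r z.2 ^ 2))) * g z.2)
          ((volume.restrict (Set.Ioi 0)).prod μ) :=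
        (Measurable.aestronglyMeasurable (by fun_prop)).mul hg.comp_snd
      rw [integrable_prod_iff' hmeas]
      refine ⟨.of_forall fun x => ?_, ?_⟩
      · exact (integrableOn_rpow_mul_one_sub_exp_mul ha₀ ha₁ (sq_nonneg (r x))).mul_const (g x)
      · have : ∀ x, ∫ s in Set.Ioi (0:ℝ), ‖s ^ (-1 - a) * (1 - Real.exp (-(s * r x ^ 2))) * g x‖
            = κ * ‖r x ^ α * g x‖ := by
          intro x
          simp only [norm_mul (_ * _) (g x)]
          rw [integral_mul_const, setIntegral_congr_fun measurableSet_Ioi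
            (g := fun s : ℝ => s ^ (-1 - a) * (1 - Real.exp (-(s * r x ^ 2)))),
            setIntegral_rpow_mul_one_sub_exp_mul ha₀ (sq_nonneg _), hra, norm_mul,
            Real.norm_of_nonneg (Real.rpow_nonneg (hr₀ x) _)]
          · ring
          · intro s hs
            have hs : 0 < s := hs
            exact Real.norm_of_nonneg (mul_nonneg (by positivity) (hbd s hs x))
        simp only [this]
        exact hrg.norm.const_mul _
    have hswap := integral_integral_swap (f := fun (s : ℝ) (x : X) =>
      s ^ (-1 - a) * (1 - Real.exp (-(s * r x ^ 2))) * g x) hint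
    have hinner : ∀ x, ∫ s in Set.Ioi (0:ℝ), s ^ (-1 - a) * (1 - Real.exp (-(s * r x ^ 2))) * g x
        = κ * (r x ^ α * g x) := fun x => by
      rw [integral_mul_const, setIntegral_rpow_mul_one_sub_exp_mul ha₀ (sq_nonneg _), hra]
      ring
    simp only [hinner, integral_const_mul] at hswap
    have hle : κ * ∫ x, r x ^ α * g x ∂μ ≤ 0 := by
      rw [← hswap]
      refine setIntegral_nonpos measurableSet_Ioi fun s hs => ?_
      have hs : 0 < s := hs
      simp only [mul_assoc, integral_const_mul]
      exact mul_nonpos_of_nonneg_of_nonpos (by positivity) (h s hs)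
    exact nonpos_of_mul_nonpos_right hle hκ

/-! ### Fourier multipliers on smooth compactly supported functions. -/

section FracLaplacian

variable {N : ℕ} {f g : EuclideanSpace ℝ (Fin N) → ℝ}

/-- A smooth compactly supported real function as a complex-valued Schwartz function. -/
noncomputable def toComplexSchwartz (hf : ContDiff ℝ ∞ f) (hc : HasCompactSupport f) :
    SchwartzMap (EuclideanSpace ℝ (Fin N)) ℂ :=
  (hc.comp_left (g := ((↑) : ℝ → ℂ)) Complex.ofReal_zero).toSchwartzMap
    (Complex.ofRealCLM.contDiff.comp hf)

lemma coe_toComplexSchwartz (hf : ContDiff ℝ ∞ f) (hc : HasCompactSupport f) :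
    ⇑(toComplexSchwartz hf hc) = fun y => (f y : ℂ) := rfl

lemma coe_fourier_toComplexSchwartz (hf : ContDiff ℝ ∞ f) (hc : HasCompactSupport f) :
    ⇑(𝓕 (toComplexSchwartz hf hc) : SchwartzMap (EuclideanSpace ℝ (Fin N)) ℂ) = 𝓕 (fun y => (f y : ℂ)) := rfl

lemma integrable_fourier_ofReal (hf : ContDiff ℝ ∞ f) (hc : HasCompactSupport f) :
    Integrable (𝓕 (fun y => (f y : ℂ))) := by
  rw [← coe_fourier_toComplexSchwartz hf hc]
  exact SchwartzMap.integrable _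

lemma continuous_fourier_ofReal (hf : ContDiff ℝ ∞ f) (hc : HasCompactSupport f) :
    Continuous (𝓕 (fun y => (f y : ℂ))) := by
  rw [← coe_fourier_toComplexSchwartz hf hc]
  exact SchwartzMap.continuous _

lemma integrable_rpow_mul_fourier_ofReal {α : ℝ} (hα₀ : 0 < α) (hα₂ : α ≤ 2)
    (hf : ContDiff ℝ ∞ f) (hc : HasCompactSupport f) :
    Integrable (fun ξ : EuclideanSpace ℝ (Fin N) =>
      (((2 * Real.pi * ‖ξ‖) ^ α : ℝ) : ℂ) * 𝓕 (fun y => (f y : ℂ)) ξ) := by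
  have h2 : Integrable (fun ξ : EuclideanSpace ℝ (Fin N) =>
      ‖ξ‖ ^ 2 * ‖𝓕 (fun y => (f y : ℂ)) ξ‖) := by
    simpa only [← coe_fourier_toComplexSchwartz hf hc] using
      SchwartzMap.integrable_pow_mul volume (𝓕 (toComplexSchwartz hf hc)) 2
  refine Integrable.mono' ((integrable_fourier_ofReal hf hc).norm.add
    (h2.const_mul ((2 * Real.pi) ^ 2))) ?_ (.of_forall fun ξ => ?_)
  · refine (Continuous.mul ?_ (continuous_fourier_ofReal hf hc)).aestronglyMeasurable
    exact Complex.continuous_ofReal.comp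
      (Continuous.rpow_const (by fun_prop) fun _ => Or.inr hα₀.le)
  · rw [norm_mul, Complex.norm_real, Real.norm_of_nonneg (by positivity)]
    have : (2 * Real.pi * ‖ξ‖) ^ α ≤ 1 + (2 * Real.pi) ^ 2 * ‖ξ‖ ^ 2 := by
      rw [← mul_pow]
      set r := 2 * Real.pi * ‖ξ‖
      have hr : 0 ≤ r := by positivity
      rcases le_total r 1 with h | h
      · have := Real.rpow_le_one hr h hα₀.le
        nlinarith
      · have := Real.rpow_le_rpow_of_exponent_le h hα₂
        rw [Real.rpow_two] at this
        linarith
    calc _ ≤ (1 + (2 * Real.pi) ^ 2 * ‖ξ‖ ^ 2) * ‖𝓕 (fun y => (f y : ℂ)) ξ‖ := by gcongr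
      _ = _ := by simp only [Pi.add_apply]; ring

/-- The real part of the integrand of Fourier inversion. -/
noncomputable def inversionIntegrand (f : EuclideanSpace ℝ (Fin N) → ℝ)
    (x ξ : EuclideanSpace ℝ (Fin N)) : ℝ :=
  (Complex.exp ((2 * Real.pi * inner ℝ ξ x : ℝ) * Complex.I) * 𝓕 (fun y => (f y : ℂ)) ξ).re

lemma norm_cexp_ofReal_mul_I_mul (θ : ℝ) (z : ℂ) : ‖Complex.exp (θ * Complex.I) * z‖ = ‖z‖ := by
  rw [norm_mul, Complex.norm_exp_ofReal_mul_I, one_mul]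

/-- Real symbols come out of the real part, so `f x`, `Λ^α f x` and Gaussian averages of `f` all
become integrals of one real density against different symbols. This is the setting of
`integral_rpow_mul_nonpos`. -/
lemma re_fourierInv_ofReal_mul {m : EuclideanSpace ℝ (Fin N) → ℝ}
    (hm : Integrable (fun ξ => (m ξ : ℂ) * 𝓕 (fun y => (f y : ℂ)) ξ))
    (x : EuclideanSpace ℝ (Fin N)) :
    Integrable (fun ξ => m ξ * inversionIntegrand f x ξ) ∧
    (𝓕⁻ (fun ξ => (m ξ : ℂ) * 𝓕 (fun y => (f y : ℂ)) ξ) x).re =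
      ∫ ξ, m ξ * inversionIntegrand f x ξ := by
  have hint : Integrable (fun ξ => Complex.exp ((2 * Real.pi * inner ℝ ξ x : ℝ) * Complex.I) *
      ((m ξ : ℂ) * 𝓕 (fun y => (f y : ℂ)) ξ)) := by
    refine hm.mono ?_ (.of_forall fun ξ => (norm_cexp_ofReal_mul_I_mul _ _).le)
    exact (Continuous.aestronglyMeasurable (by fun_prop)).mul hm.aestronglyMeasurable
  have hre : ∀ ξ, (Complex.exp ((2 * Real.pi * inner ℝ ξ x : ℝ) * Complex.I) *
      ((m ξ : ℂ) * 𝓕 (fun y => (f y : ℂ)) ξ)).re = m ξ * inversionIntegrand f x ξ := fun ξ => by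
    rw [mul_left_comm, Complex.re_ofReal_mul, inversionIntegrand]
  refine ⟨hint.re.congr (.of_forall hre), ?_⟩
  rw [Real.fourierInv_eq']
  simp only [smul_eq_mul]
  rw [← Complex.reCLM_apply, ← Complex.reCLM.integral_comp_comm hint]
  simp only [Complex.reCLM_apply, hre]

lemma integral_inversionIntegrand (hf : ContDiff ℝ ∞ f) (hc : HasCompactSupport f)
    (x : EuclideanSpace ℝ (Fin N)) :
    Integrable (inversionIntegrand f x) ∧ ∫ ξ, inversionIntegrand f x ξ = f x := by
  have h := integrable_fourier_ofReal hf hc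
  have h1 := re_fourierInv_ofReal_mul (m := fun _ => 1) (f := f) (by simpa using h) x
  simp only [Complex.ofReal_one, one_mul] at h1
  refine ⟨h1.1, ?_⟩
  have hcont : Continuous (fun y => (f y : ℂ)) := Complex.continuous_ofReal.comp hf.continuous
  rw [← h1.2]
  have := congrFun (hcont.fourierInv_fourier_eq (toComplexSchwartz hf hc).integrable h) x
  change (𝓕⁻ (𝓕 (fun y => (f y : ℂ))) x).re = f x
  rw [this, Complex.ofReal_re]

lemma fracLaplacian_eq_integral {α : ℝ} (hα₀ : 0 < α) (hα₂ : α ≤ 2)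
    (hf : ContDiff ℝ ∞ f) (hc : HasCompactSupport f) (x : EuclideanSpace ℝ (Fin N)) :
    Integrable (fun ξ => (2 * Real.pi * ‖ξ‖) ^ α * inversionIntegrand f x ξ) ∧
    fracLaplacian α f x = ∫ ξ, (2 * Real.pi * ‖ξ‖) ^ α * inversionIntegrand f x ξ :=
  re_fourierInv_ofReal_mul (integrable_rpow_mul_fourier_ofReal hα₀ hα₂ hf hc) x

lemma inversionIntegrand_sub_const_mul (c : ℝ) (hf : ContDiff ℝ ∞ f) (hcf : HasCompactSupport f)
    (hg : ContDiff ℝ ∞ g) (hcg : HasCompactSupport g) (x ξ : EuclideanSpace ℝ (Fin N)) :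
    inversionIntegrand (fun y => f y - c * g y) x ξ =
      inversionIntegrand f x ξ - c * inversionIntegrand g x ξ := by
  have h : 𝓕 (fun y => ((f y - c * g y : ℝ) : ℂ)) ξ =
      𝓕 (fun y => (f y : ℂ)) ξ - c * 𝓕 (fun y => (g y : ℂ)) ξ := by
    have := congrArg (fun F : SchwartzMap (EuclideanSpace ℝ (Fin N)) ℂ => F ξ)
      (show 𝓕 (toComplexSchwartz hf hcf + (-(c : ℂ)) • toComplexSchwartz hg hcg) =
        𝓕 (toComplexSchwartz hf hcf) + (-(c : ℂ)) • 𝓕 (toComplexSchwartz hg hcg) by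
          rw [FourierTransform.fourier_add, FourierTransform.fourier_smul])
    simp only [add_apply, smul_apply, smul_eq_mul, SchwartzMap.fourier_coe,
      coe_toComplexSchwartz] at this
    rw [sub_eq_add_neg, ← neg_mul, ← this]
    refine congrArg (fun F : EuclideanSpace ℝ (Fin N) → ℂ => 𝓕 F ξ) (funext fun y => ?_)
    simp only [sub_eq_add_neg, add_apply, smul_apply, coe_toComplexSchwartz, smul_eq_mul]
    push_cast
    ring
  rw [inversionIntegrand, h, inversionIntegrand, inversionIntegrand, mul_sub, mul_left_comm,
    Complex.sub_re, Complex.re_ofReal_mul]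

lemma fracLaplacian_sub_const_mul {α : ℝ} (hα₀ : 0 < α) (hα₂ : α ≤ 2) (c : ℝ)
    (hf : ContDiff ℝ ∞ f) (hcf : HasCompactSupport f)
    (hg : ContDiff ℝ ∞ g) (hcg : HasCompactSupport g) (x : EuclideanSpace ℝ (Fin N)) :
    fracLaplacian α (fun y => f y - c * g y) x = fracLaplacian α f x - c * fracLaplacian α g x := by
  have hF := fracLaplacian_eq_integral hα₀ hα₂ hf hcf x
  have hG := fracLaplacian_eq_integral hα₀ hα₂ hg hcg x
  rw [(fracLaplacian_eq_integral hα₀ hα₂ (hf.sub (contDiff_const.mul hg))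
    (hcf.sub hcg.mul_left) x).2, hF.2, hG.2, ← integral_const_mul, ← integral_sub hF.1
    (hG.1.const_mul c)]
  congr 1
  ext ξ
  rw [← mul_left_comm, ← mul_sub, ← inversionIntegrand_sub_const_mul c hf hcf hg hcg x ξ]

lemma fracLaplacian_const_mul (α c : ℝ) (f : EuclideanSpace ℝ (Fin N) → ℝ)
    (x : EuclideanSpace ℝ (Fin N)) :
    fracLaplacian α (fun y => c * f y) x = c * fracLaplacian α f x := by
  have h : ∀ ξ, 𝓕 (fun y => ((c * f y : ℝ) : ℂ)) ξ = c * 𝓕 (fun y => (f y : ℂ)) ξ := fun ξ => by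
    rw [Real.fourier_eq, Real.fourier_eq, ← integral_const_mul]
    congr 1
    ext y
    simp only [Circle.smul_def, smul_eq_mul]
    push_cast
    ring
  rw [fracLaplacian, fracLaplacian, ← Complex.re_ofReal_mul, Real.fourierInv_eq,
    Real.fourierInv_eq, ← integral_const_mul]
  congr 2
  ext ξ
  rw [h]
  simp only [Circle.smul_def, smul_eq_mul]
  ring

end FracLaplacian

/-! ### Maximum principle, Córdoba–Córdoba inequality and scaling of `Λ^α`. -/

section MaximumPrinciple

variable {N : ℕ} {f : EuclideanSpace ℝ (Fin N) → ℝ}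

/-- The total mass of the kernel whose Fourier symbol is a Gaussian is one. -/
lemma integral_gaussian_kernel {V : Type*} [NormedAddCommGroup V] [InnerProductSpace ℝ V]
    [FiniteDimensional ℝ V] [MeasurableSpace V] [BorelSpace V] {b : ℝ} (hb : 0 < b) (x : V) :
    Integrable (fun y : V => (Real.pi / b) ^ (Module.finrank ℝ V / 2 : ℝ) *
      Real.exp (-(Real.pi ^ 2 / b) * ‖x - y‖ ^ 2)) ∧
    ∫ y : V, (Real.pi / b) ^ (Module.finrank ℝ V / 2 : ℝ) *
      Real.exp (-(Real.pi ^ 2 / b) * ‖x - y‖ ^ 2) = 1 := by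
  have hpi := Real.pi_pos
  have hb' : 0 < Real.pi ^ 2 / b := by positivity
  have hval : ∫ y : V, (Real.pi / b) ^ (Module.finrank ℝ V / 2 : ℝ) *
      Real.exp (-(Real.pi ^ 2 / b) * ‖x - y‖ ^ 2) = 1 := by
    rw [integral_const_mul,
      integral_sub_left_eq_self (fun y : V => Real.exp (-(Real.pi ^ 2 / b) * ‖y‖ ^ 2)) volume x,
      GaussianFourier.integral_rexp_neg_mul_sq_norm hb', ← Real.mul_rpow (by positivity)
      (by positivity)]
    have : Real.pi / b * (Real.pi / (Real.pi ^ 2 / b)) = 1 := by field_simp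
    rw [this, Real.one_rpow]
  -- A non-integrable function would have integral `0`, not `1`.
  refine ⟨by_contra fun h => ?_, hval⟩
  rw [integral_undef h] at hval
  exact zero_ne_one hval

/-- Self-adjointness of the Fourier transform moves it from `f` onto a modulated Gaussian, whose
transform is a Gaussian centred at `x`. -/
lemma integral_gaussian_mul_inversionIntegrand (hf : ContDiff ℝ ∞ f) (hc : HasCompactSupport f)
    {b : ℝ} (hb : 0 < b) (x : EuclideanSpace ℝ (Fin N)) :
    ∫ ξ, Real.exp (-(b * ‖ξ‖ ^ 2)) * inversionIntegrand f x ξ =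
      ∫ y, (Real.pi / b) ^ (Module.finrank ℝ (EuclideanSpace ℝ (Fin N)) / 2 : ℝ) *
        Real.exp (-(Real.pi ^ 2 / b) * ‖x - y‖ ^ 2) * f y := by
  have hpi := Real.pi_pos
  have hbc : 0 < (b : ℂ).re := by simpa using hb
  have J : Integrable (fun w : EuclideanSpace ℝ (Fin N) =>
      Complex.exp (-b * ‖w‖ ^ 2 + 2 * Real.pi * Complex.I * inner ℝ x w)) :=
    GaussianFourier.integrable_cexp_neg_mul_sq_norm_add hbc _ _
  have key : ∫ w : EuclideanSpace ℝ (Fin N),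
      𝓕 (fun w => Complex.exp (-b * ‖w‖ ^ 2 + 2 * Real.pi * Complex.I * inner ℝ x w)) w • (f w : ℂ)
      = ∫ w, Complex.exp (-b * ‖w‖ ^ 2 + 2 * Real.pi * Complex.I * inner ℝ x w) •
        𝓕 (fun y => (f y : ℂ)) w := by
    simpa using! (VectorFourier.integral_fourierIntegral_smul_eq_flip
      (L := innerₗ (EuclideanSpace ℝ (Fin N)))
      Real.continuous_fourierChar continuous_inner J (toComplexSchwartz hf hc).integrable)
  have hm : Integrable (fun ξ : EuclideanSpace ℝ (Fin N) =>
      ((Real.exp (-(b * ‖ξ‖ ^ 2)) : ℝ) : ℂ) * 𝓕 (fun y => (f y : ℂ)) ξ) := by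
    refine (integrable_fourier_ofReal hf hc).mono ?_ (.of_forall fun ξ => ?_)
    · refine (Continuous.mul (by fun_prop) (continuous_fourier_ofReal hf hc)).aestronglyMeasurable
    · rw [norm_mul, Complex.norm_real, Real.norm_of_nonneg (Real.exp_pos _).le]
      refine mul_le_of_le_one_left (norm_nonneg _) (Real.exp_le_one_iff.2 ?_)
      simp only [neg_nonpos]
      positivity
  rw [← (re_fourierInv_ofReal_mul hm x).2, Real.fourierInv_eq', ← Complex.ofReal_re
    (∫ y, (Real.pi / b) ^ (Module.finrank ℝ (EuclideanSpace ℝ (Fin N)) / 2 : ℝ) *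
        Real.exp (-(Real.pi ^ 2 / b) * ‖x - y‖ ^ 2) * f y), ← integral_complex_ofReal]
  congr 1
  calc _ = ∫ w, Complex.exp (-b * ‖w‖ ^ 2 + 2 * Real.pi * Complex.I * inner ℝ x w) •
        𝓕 (fun y => (f y : ℂ)) w := by
        congr 1
        ext ξ
        simp only [smul_eq_mul]
        rw [← mul_assoc, Complex.ofReal_exp, ← Complex.exp_add, real_inner_comm]
        congr 2
        push_cast
        ring
    _ = _ := by
        rw [← key]
        congr 1
        ext y
        rw [fourier_gaussian_innerProductSpace' hbc, smul_eq_mul]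
        push_cast
        rw [Complex.ofReal_cpow (by positivity)]
        push_cast
        congr 3
        ring

/-- The maximum principle: at a global minimum, `Λ^α f ≤ 0`. -/
lemma fracLaplacian_nonpos_of_forall_le {α : ℝ} (hα₀ : 0 < α) (hα₂ : α ≤ 2)
    (hf : ContDiff ℝ ∞ f) (hc : HasCompactSupport f) {x : EuclideanSpace ℝ (Fin N)}
    (hx : ∀ y, f x ≤ f y) : fracLaplacian α f x ≤ 0 := by
  obtain ⟨hint, heq⟩ := fracLaplacian_eq_integral hα₀ hα₂ hf hc x
  obtain ⟨hg, hgf⟩ := integral_inversionIntegrand hf hc x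
  rw [heq]
  refine integral_rpow_mul_nonpos hα₀ hα₂ (r := fun ξ => 2 * Real.pi * ‖ξ‖) (by fun_prop)
    (fun ξ => by positivity) hg.aestronglyMeasurable hint fun s hs => ?_
  have hb : 0 < s * (2 * Real.pi) ^ 2 := by have := Real.pi_pos; positivity
  obtain ⟨hk, hk1⟩ := integral_gaussian_kernel hb x
  have hgi : Integrable (fun ξ =>
      Real.exp (-(s * (2 * Real.pi) ^ 2 * ‖ξ‖ ^ 2)) * inversionIntegrand f x ξ) := by
    refine hg.mono ((Continuous.aestronglyMeasurable (by fun_prop)).mul hg.aestronglyMeasurable)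
      (.of_forall fun ξ => ?_)
    rw [norm_mul, Real.norm_of_nonneg (Real.exp_pos _).le]
    refine mul_le_of_le_one_left (norm_nonneg _) (Real.exp_le_one_iff.2 ?_)
    simp only [neg_nonpos]
    positivity
  simp only [mul_pow (2 * Real.pi), ← mul_assoc s, sub_mul, one_mul]
  rw [integral_sub hg hgi, hgf, integral_gaussian_mul_inversionIntegrand hf hc hb, sub_nonpos]
  obtain ⟨C, hC⟩ := hf.continuous.bounded_above_of_compact_support hc
  -- It remains to see that the minimum `f x` is at most a Gaussian average of `f`; the kernel is
  -- positive with mass one.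
  calc f x = ∫ y, (Real.pi / (s * (2 * Real.pi) ^ 2)) ^
        (Module.finrank ℝ (EuclideanSpace ℝ (Fin N)) / 2 : ℝ) *
        Real.exp (-(Real.pi ^ 2 / (s * (2 * Real.pi) ^ 2)) * ‖x - y‖ ^ 2) * f x := by
          rw [integral_mul_const, hk1, one_mul]
    _ ≤ _ := by
      refine integral_mono (hk.mul_const _)
        (hk.mul_bdd hf.continuous.aestronglyMeasurable (.of_forall hC)) fun y => ?_
      have := Real.pi_pos
      exact mul_le_mul_of_nonneg_left (hx y) (by positivity)

/-- Convexity of `t ^ (l + 1)` on `t ≥ 0`: subtracting the tangent slope at `a` leaves a function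
minimal at `a`. In the induction, the gap at `l + 1` is `b` times the gap at `l` plus `(l + 1) * a ^
l * (b - a) ^ 2`. -/
lemma pow_sub_mul_pow_mul_ge {a b : ℝ} (ha : 0 ≤ a) (hb : 0 ≤ b) (l : ℕ) :
    a ^ (l + 1) - ((l + 1 : ℕ) : ℝ) * a ^ l * a ≤ b ^ (l + 1) - ((l + 1 : ℕ) : ℝ) * a ^ l * b := by
  induction l with
  | zero => simp
  | succ l ih =>
    push_cast at ih ⊢
    have h2 : 0 ≤ (a ^ l * (l + 1)) * (b - a) ^ 2 := by positivity
    have h3 := mul_le_mul_of_nonneg_left ih hb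
    ring_nf at h2 h3 ⊢
    nlinarith

/-- The Córdoba–Córdoba inequality for powers of a nonnegative test function. -/
lemma fracLaplacian_pow_le {α : ℝ} (hα₀ : 0 < α) (hα₂ : α ≤ 2)
    (hf : ContDiff ℝ ∞ f) (hc : HasCompactSupport f) (hf₀ : ∀ x, 0 ≤ f x) (l : ℕ)
    (x : EuclideanSpace ℝ (Fin N)) :
    fracLaplacian α (fun y => f y ^ (l + 1)) x ≤
      ((l + 1 : ℕ) : ℝ) * f x ^ l * fracLaplacian α f x := by
  have hc' : HasCompactSupport (fun y => f y ^ (l + 1)) :=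
    hc.comp_left (g := fun t : ℝ => t ^ (l + 1)) (by simp)
  -- With the slope frozen at `f x`, convexity makes `x` a global minimum of this function of `y`.
  have h := fracLaplacian_nonpos_of_forall_le hα₀ hα₂ (x := x)
    (f := fun y => f y ^ (l + 1) - ((l + 1 : ℕ) : ℝ) * f x ^ l * f y)
    ((hf.pow _).sub (contDiff_const.mul hf)) (hc'.sub hc.mul_left)
    fun y => pow_sub_mul_pow_mul_ge (hf₀ x) (hf₀ y) l
  rw [fracLaplacian_sub_const_mul hα₀ hα₂ _ (hf.pow _) hc' hf hc] at h
  linarith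

lemma fourier_comp_inv_smul {V : Type*} [NormedAddCommGroup V] [InnerProductSpace ℝ V]
    [FiniteDimensional ℝ V] [MeasurableSpace V] [BorelSpace V] {R : ℝ} (hR : 0 < R) (f : V → ℂ)
    (ξ : V) :
    𝓕 (fun y => f (R⁻¹ • y)) ξ = (R ^ Module.finrank ℝ V : ℝ) * 𝓕 f (R • ξ) := by
  rw [Real.fourier_eq, Real.fourier_eq]
  have h := Measure.integral_comp_inv_smul_of_nonneg volume
    (fun y : V => Real.fourierChar (-inner ℝ y (R • ξ)) • f y) hR.le
  rw [Complex.real_smul] at h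
  rw [← h]
  congr 1
  ext y
  rw [inner_smul_left, inner_smul_right]
  simp [hR.ne']

lemma fracLaplacian_comp_inv_smul (α : ℝ) {R : ℝ} (hR : 0 < R)
    (f : EuclideanSpace ℝ (Fin N) → ℝ) (x : EuclideanSpace ℝ (Fin N)) :
    fracLaplacian α (fun y => f (R⁻¹ • y)) x = R ^ (-α) * fracLaplacian α f (R⁻¹ • x) := by
  rw [fracLaplacian, fracLaplacian, ← Complex.re_ofReal_mul, Real.fourierInv_eq,
    Real.fourierInv_eq]
  have h := Measure.integral_comp_smul_of_nonneg volume
    (fun ξ : EuclideanSpace ℝ (Fin N) => Real.fourierChar (inner ℝ ξ (R⁻¹ • x)) •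
      ((((2 * Real.pi * ‖ξ‖) ^ α : ℝ) : ℂ) * 𝓕 (fun y => (f y : ℂ)) ξ)) R (hR := hR.le)
  have hRn : (R ^ Module.finrank ℝ (EuclideanSpace ℝ (Fin N)) : ℝ) ≠ 0 := by positivity
  rw [Complex.real_smul, ← mul_right_inj' (Complex.ofReal_ne_zero.2 hRn), ← mul_assoc,
    ← Complex.ofReal_mul, mul_inv_cancel₀ hRn, Complex.ofReal_one, one_mul] at h
  rw [← h, ← integral_const_mul, ← integral_const_mul]
  congr 2
  ext ξ
  rw [fourier_comp_inv_smul hR (fun y => (f y : ℂ)), inner_smul_left, inner_smul_right, norm_smul,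
    Real.norm_of_nonneg hR.le, mul_left_comm (2 * Real.pi) R,
    Real.mul_rpow hR.le (by positivity)]
  have h1 : (R : ℝ) ^ (-α) * R ^ α = 1 := by rw [← Real.rpow_add hR]; simp
  have h2 : (((R : ℝ) ^ (-α) : ℝ) : ℂ) * ((R ^ α : ℝ) : ℂ) = 1 := by
    rw [← Complex.ofReal_mul, h1, Complex.ofReal_one]
  have h3 : (starRingEnd ℝ) R * (R⁻¹ * inner ℝ ξ x) = inner ℝ ξ x := by
    simp [hR.ne']
  rw [h3]
  simp only [Circle.smul_def, smul_eq_mul, Complex.ofReal_mul]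
  linear_combination (-(Real.fourierChar (inner ℝ ξ x) : ℂ) *
    ((R ^ Module.finrank ℝ (EuclideanSpace ℝ (Fin N)) : ℝ) : ℂ) *
    (((2 * Real.pi * ‖ξ‖) ^ α : ℝ) : ℂ) * 𝓕 (fun y => (f y : ℂ)) (R • ξ)) * h2

/-- The constant is the `L¹` norm of the symbol times the transform. No regularity is needed: a
divergent inversion integral is `0` by convention. -/
lemma exists_fracLaplacian_le (α : ℝ) (f : EuclideanSpace ℝ (Fin N) → ℝ) :
    ∃ C, 0 ≤ C ∧ ∀ x, fracLaplacian α f x ≤ C := by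
  refine ⟨∫ ξ : EuclideanSpace ℝ (Fin N), ‖(((2 * Real.pi * ‖ξ‖) ^ α : ℝ) : ℂ) *
    𝓕 (fun y => (f y : ℂ)) ξ‖, by positivity, fun x => ?_⟩
  refine (Complex.re_le_norm _).trans ?_
  rw [Real.fourierInv_eq']
  refine (norm_integral_le_integral_norm _).trans_eq ?_
  simp only [smul_eq_mul, norm_cexp_ofReal_mul_I_mul]

end MaximumPrinciple

/-! ### Space-time cut-offs and their derivatives. -/

section CutOff

variable {N : ℕ}

/-- The space-time cut-off `η (t / τ) * ψ (x / R)` built from two bump functions. -/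
noncomputable def cutOff (η : ContDiffBump (0 : ℝ)) (ψ : ContDiffBump (0 : EuclideanSpace ℝ (Fin N)))
    (τ R : ℝ) (z : ℝ × EuclideanSpace ℝ (Fin N)) : ℝ :=
  η (τ⁻¹ * z.1) * ψ (R⁻¹ • z.2)

variable {η : ContDiffBump (0 : ℝ)} {ψ : ContDiffBump (0 : EuclideanSpace ℝ (Fin N))} {τ R : ℝ}

lemma cutOff_nonneg (z : ℝ × EuclideanSpace ℝ (Fin N)) : 0 ≤ cutOff η ψ τ R z :=
  mul_nonneg η.nonneg ψ.nonneg

lemma cutOff_le_one (z : ℝ × EuclideanSpace ℝ (Fin N)) : cutOff η ψ τ R z ≤ 1 :=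
  mul_le_one₀ η.le_one ψ.nonneg ψ.le_one

lemma contDiff_cutOff : ContDiff ℝ ∞ (cutOff η ψ τ R) := by
  unfold cutOff
  exact (η.contDiff.comp (contDiff_const.mul contDiff_fst)).mul
    (ψ.contDiff.comp (contDiff_snd.const_smul R⁻¹))

lemma cutOff_eq_zero (hτ : 0 < τ) (hR : 0 < R) {z : ℝ × EuclideanSpace ℝ (Fin N)}
    (hz : ¬ (|z.1| ≤ η.rOut * τ ∧ ‖z.2‖ ≤ ψ.rOut * R)) : cutOff η ψ τ R z = 0 := by
  rw [not_and_or, not_le, not_le] at hz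
  rcases hz with h | h
  · rw [cutOff, η.zero_of_le_dist, zero_mul]
    rw [dist_zero_right, norm_mul, norm_inv, Real.norm_of_nonneg hτ.le, Real.norm_eq_abs,
      le_inv_mul_iff₀ hτ]
    linarith
  · rw [cutOff, ψ.zero_of_le_dist, mul_zero]
    rw [dist_zero_right, norm_smul, norm_inv, Real.norm_of_nonneg hR.le, le_inv_mul_iff₀ hR]
    linarith

lemma cutOff_eq_one (hτ : 0 < τ) (hR : 0 < R) {z : ℝ × EuclideanSpace ℝ (Fin N)}
    (h1 : |z.1| ≤ η.rIn * τ) (h2 : ‖z.2‖ ≤ ψ.rIn * R) : cutOff η ψ τ R z = 1 := by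
  rw [cutOff, η.one_of_mem_closedBall, ψ.one_of_mem_closedBall, one_mul]
  · rw [mem_closedBall_zero_iff, norm_smul, norm_inv, Real.norm_of_nonneg hR.le,
      inv_mul_le_iff₀ hR]
    linarith
  · rw [mem_closedBall_zero_iff, norm_mul, norm_inv, Real.norm_of_nonneg hτ.le, Real.norm_eq_abs,
      inv_mul_le_iff₀ hτ]
    linarith

lemma isTestFunction_cutOff_pow (hτ : 0 < τ) (hR : 0 < R) (l : ℕ) :
    IsTestFunction ⊤ (fun z => cutOff η ψ τ R z ^ (l + 1)) where
  smooth := contDiff_cutOff.pow _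
  compact := by
    refine HasCompactSupport.intro ((isCompact_Icc (a := -(η.rOut * τ)) (b := η.rOut * τ)).prod
      (isCompact_closedBall (0 : EuclideanSpace ℝ (Fin N)) (ψ.rOut * R))) fun z hz => ?_
    rw [cutOff_eq_zero hτ hR, zero_pow (Nat.succ_ne_zero l)]
    simpa [abs_le, Set.mem_prod] using hz
  support := fun _ _ => ENNReal.ofReal_lt_top

lemma fracLaplacian_cutOff_pow_le {α C : ℝ} (hα₀ : 0 < α) (hα₂ : α ≤ 2) (hC₀ : 0 ≤ C)
    (hC : ∀ x, fracLaplacian α ψ x ≤ C) (hR : 0 < R) (l : ℕ)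
    (z : ℝ × EuclideanSpace ℝ (Fin N)) :
    fracLaplacian α (fun y => cutOff η ψ τ R (z.1, y) ^ (l + 1)) z.2 ≤
      (l + 1) * C * R ^ (-α) * cutOff η ψ τ R z ^ l := by
  have hc : HasCompactSupport (fun y => ψ (R⁻¹ • y)) :=
    ψ.hasCompactSupport.comp_smul (inv_ne_zero hR.ne')
  have hs : ContDiff ℝ ∞ (fun y => ψ (R⁻¹ • y)) :=
    ψ.contDiff.comp (contDiff_id.const_smul R⁻¹)
  simp only [cutOff, mul_pow]
  rw [fracLaplacian_const_mul]
  have h1 := fracLaplacian_pow_le hα₀ hα₂ hs hc (fun _ => ψ.nonneg) l z.2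
  rw [fracLaplacian_comp_inv_smul α hR] at h1
  have hη := η.nonneg (x := τ⁻¹ * z.1)
  have hψ := ψ.nonneg (x := R⁻¹ • z.2)
  calc _ ≤ η (τ⁻¹ * z.1) ^ (l + 1) *
        (((l + 1 : ℕ) : ℝ) * ψ (R⁻¹ • z.2) ^ l * (R ^ (-α) * C)) := by
        refine mul_le_mul_of_nonneg_left (h1.trans ?_) (by positivity)
        have := hC (R⁻¹ • z.2)
        gcongr
    -- One factor `η ≤ 1` is given up so that the bound is in terms of `θ ^ l`.
    _ ≤ η (τ⁻¹ * z.1) ^ l * (((l + 1 : ℕ) : ℝ) * ψ (R⁻¹ • z.2) ^ l * (R ^ (-α) * C)) := by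
        refine mul_le_mul_of_nonneg_right ?_ (by positivity)
        exact pow_le_pow_of_le_one hη η.le_one (Nat.le_succ l)
    _ = _ := by push_cast; ring

/-- Since `η` is constant on the ball of radius `1`, the derivative vanishes for `0 < t < τ`. The
resulting indicator is what later turns the time term into a vanishing tail. -/
lemma neg_deriv_cutOff_pow_le {C : ℝ} (hη1 : η.rIn = 1) (hC : ∀ s, ‖deriv η s‖ ≤ C) (hτ : 0 < τ)
    (l : ℕ) {z : ℝ × EuclideanSpace ℝ (Fin N)} (hz : 0 < z.1) :
    -deriv (fun s => cutOff η ψ τ R (s, z.2) ^ (l + 1)) z.1 ≤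
      {z : ℝ × EuclideanSpace ℝ (Fin N) | τ ≤ z.1}.indicator
        (fun z => (l + 1) * C * τ⁻¹ * cutOff η ψ τ R z ^ l) z := by
  have hd : HasDerivAt η (deriv η (τ⁻¹ * z.1)) (τ⁻¹ * z.1) :=
    ((η.contDiff (n := 1)).differentiable one_ne_zero _).hasDerivAt
  have hlin : HasDerivAt (fun s : ℝ => τ⁻¹ * s) τ⁻¹ z.1 := by
    simpa using (hasDerivAt_id z.1).const_mul τ⁻¹
  have h := ((hd.comp z.1 hlin).mul_const (ψ (R⁻¹ • z.2))).pow (l + 1)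
  have h' : deriv (fun s => cutOff η ψ τ R (s, z.2) ^ (l + 1)) z.1 =
      ((l + 1 : ℕ) : ℝ) * cutOff η ψ τ R z ^ l *
        (deriv η (τ⁻¹ * z.1) * τ⁻¹ * ψ (R⁻¹ • z.2)) := h.deriv
  rw [h']
  by_cases ht : τ ≤ z.1
  · rw [Set.indicator_of_mem (show z ∈ {z : ℝ × EuclideanSpace ℝ (Fin N) | τ ≤ z.1} from ht)]
    have h0 := cutOff_nonneg (η := η) (ψ := ψ) (τ := τ) (R := R) z
    have h1 : -deriv η (τ⁻¹ * z.1) ≤ C := (neg_le_abs _).trans (hC _)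
    have hC0 : 0 ≤ C := (norm_nonneg _).trans (hC 0)
    have h2 : -deriv η (τ⁻¹ * z.1) * ψ (R⁻¹ • z.2) ≤ C * 1 := by
      calc _ ≤ C * ψ (R⁻¹ • z.2) := mul_le_mul_of_nonneg_right h1 ψ.nonneg
        _ ≤ C * 1 := mul_le_mul_of_nonneg_left ψ.le_one hC0
    calc _ = ((l + 1 : ℕ) : ℝ) * cutOff η ψ τ R z ^ l * τ⁻¹ *
          (-deriv η (τ⁻¹ * z.1) * ψ (R⁻¹ • z.2)) := by ring
      _ ≤ ((l + 1 : ℕ) : ℝ) * cutOff η ψ τ R z ^ l * τ⁻¹ * (C * 1) :=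
          mul_le_mul_of_nonneg_left h2 (by positivity)
      _ = _ := by push_cast; ring
  · rw [Set.indicator_of_notMem
      (show z ∉ {z : ℝ × EuclideanSpace ℝ (Fin N) | τ ≤ z.1} from ht)]
    have hmem : τ⁻¹ * z.1 ∈ Metric.ball (0 : ℝ) η.rIn := by
      rw [mem_ball_zero_iff, Real.norm_of_nonneg (by positivity), hη1, inv_mul_lt_iff₀ hτ]
      linarith
    rw [(η.eventuallyEq_one_of_mem_ball hmem).deriv_eq]
    simp

end CutOff

/-! ### Young's inequality and the test function estimate. -/

/-- Young's inequality for `ε ^ p⁻¹ * (v * θ ^ l)` and `ε ^ (-p⁻¹) * M`. The condition on `l` gives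
`θ ^ (l * p) ≤ θ ^ (l + 1)`, so the weight is again the test function. -/
lemma mul_mul_pow_le_young {p q : ℝ} (hpq : p.HolderConjugate q) {l : ℕ} (hl : l + 1 ≤ l * p)
    {v θ M ε : ℝ} (hv : 0 ≤ v) (hθ₀ : 0 ≤ θ) (hθ₁ : θ ≤ 1) (hM : 0 ≤ M) (hε : 0 < ε) :
    v * (M * θ ^ l) ≤ ε * (v ^ p * θ ^ (l + 1)) + ε ^ (-(q / p)) * M ^ q := by
  have hp := hpq.pos
  have hq := hpq.symm.pos
  have hy := Real.young_inequality_of_nonneg (a := ε ^ p⁻¹ * (v * θ ^ l)) (b := ε ^ (-p⁻¹) * M)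
    (by positivity) (by positivity) hpq
  have h1 : ε ^ p⁻¹ * ε ^ (-p⁻¹) = 1 := by rw [← Real.rpow_add hε]; simp
  have h2 : (ε ^ p⁻¹ * (v * θ ^ l)) ^ p = ε * (v ^ p * (θ ^ l) ^ p) := by
    rw [Real.mul_rpow (by positivity) (by positivity), Real.mul_rpow hv (by positivity),
      ← Real.rpow_mul hε.le, inv_mul_cancel₀ hp.ne', Real.rpow_one]
  have h3 : (ε ^ (-p⁻¹) * M) ^ q = ε ^ (-(q / p)) * M ^ q := by
    rw [Real.mul_rpow (by positivity) hM, ← Real.rpow_mul hε.le]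
    congr 2
    ring
  have h4 : (θ ^ l) ^ p ≤ θ ^ (l + 1) := by
    rw [← Real.rpow_natCast θ l, ← Real.rpow_natCast θ (l + 1), ← Real.rpow_mul hθ₀]
    rcases hθ₀.eq_or_lt with rfl | h0
    · have : (l : ℝ) * p ≠ 0 := by
        have : (0:ℝ) ≤ l := l.cast_nonneg
        linarith
      rw [Real.zero_rpow this]
      positivity
    · exact Real.rpow_le_rpow_of_exponent_ge h0 hθ₁ (by push_cast; exact hl)
  rw [h2, h3] at hy
  calc v * (M * θ ^ l) = (ε ^ p⁻¹ * (v * θ ^ l)) * (ε ^ (-p⁻¹) * M) := by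
        linear_combination (-(v * (M * θ ^ l))) * h1
    _ ≤ _ := hy
    _ ≤ ε * (v ^ p * (θ ^ l) ^ p) + ε ^ (-(q / p)) * M ^ q := by
        gcongr
        · exact div_le_self (by positivity) hpq.lt.le
        · exact div_le_self (by positivity) hpq.symm.lt.le
    _ ≤ _ := by gcongr

lemma slab_top (N : ℕ) : slab N ⊤ = {z | 0 < z.1} := by
  ext z; simp [slab]

lemma measurableSet_slab_top (N : ℕ) : MeasurableSet (slab N ⊤) := by
  rw [slab_top]; exact measurableSet_lt measurable_const measurable_fst

lemma ae_slab_top_pos (N : ℕ) : ∀ᵐ z ∂volume.restrict (slab N ⊤), 0 < z.1 := by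
  filter_upwards [ae_restrict_mem (measurableSet_slab_top N)] with z hz
  rwa [slab_top] at hz

/-- The part of the slab where the cut-off at scales `τ` and `R` can be nonzero. -/
def spaceTimeCylinder (N : ℕ) (τ R : ℝ) : Set (ℝ × EuclideanSpace ℝ (Fin N)) :=
  Set.Icc 0 τ ×ˢ Metric.closedBall 0 R

lemma measurableSet_spaceTimeCylinder (N : ℕ) (τ R : ℝ) : MeasurableSet (spaceTimeCylinder N τ R) :=
  measurableSet_Icc.prod Metric.isClosed_closedBall.measurableSet

lemma volume_spaceTimeCylinder {N : ℕ} {τ R : ℝ} (hτ : 0 ≤ τ) (hR : 0 ≤ R) :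
    volume (spaceTimeCylinder N τ R) < ⊤ ∧ volume.real (spaceTimeCylinder N τ R) =
      τ * (R ^ N * volume.real (Metric.ball (0 : EuclideanSpace ℝ (Fin N)) 1)) := by
  have h : volume (spaceTimeCylinder N τ R) = ENNReal.ofReal τ *
      (ENNReal.ofReal (R ^ N) * volume (Metric.ball (0 : EuclideanSpace ℝ (Fin N)) 1)) := by
    rw [spaceTimeCylinder, Measure.volume_eq_prod, Measure.prod_prod, Real.volume_Icc, sub_zero,
      Measure.addHaar_closedBall _ _ hR, finrank_euclideanSpace_fin]
  constructor
  · rw [h]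
    exact ENNReal.mul_lt_top ENNReal.ofReal_lt_top
      (ENNReal.mul_lt_top ENNReal.ofReal_lt_top measure_ball_lt_top)
  · rw [Measure.real, h, ENNReal.toReal_mul, ENNReal.toReal_mul, ENNReal.toReal_ofReal hτ,
      ENNReal.toReal_ofReal (by positivity), Measure.real]

/-- The rescaled test function estimate on which the blow-up argument rests. -/
lemma exists_testFunction_estimate {N : ℕ} {α : ℝ} (hα₀ : 0 < α) (hα₂ : α ≤ 2)
    {p q : ℝ} (hpq : p.HolderConjugate q) {u₀ : EuclideanSpace ℝ (Fin N) → ℝ}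
    (hu₀_nonneg : 0 ≤ᵐ[volume] u₀) {u : ℝ × EuclideanSpace ℝ (Fin N) → ℝ}
    (hu : IsWeakSolution α 1 p u₀ ⊤ u) (hu_nonneg : 0 ≤ᵐ[volume.restrict (slab N ⊤)] u) :
    ∃ D, 0 ≤ D ∧ ∀ τ > 0, ∀ R > 0, ∃ φ : ℝ × EuclideanSpace ℝ (Fin N) → ℝ,
      (∀ z, 0 ≤ φ z) ∧ (∀ z, φ z ≤ 1) ∧ (∀ z, 0 < z.1 → z.1 ≤ τ → ‖z.2‖ ≤ R → φ z = 1) ∧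
      IntegrableOn (fun z => u z ^ p * φ z) (slab N ⊤) ∧
      ∀ ε > 0, ∀ A > 0, ∫ z in slab N ⊤, u z ^ p * φ z ≤
        ε * (∫ z in slab N ⊤, u z ^ p * φ z)
          + A * (∫ z in slab N ⊤, {z | τ ≤ z.1}.indicator (fun z => u z ^ p * φ z) z)
          + D * (ε ^ (-(q / p)) * R ^ (-(α * q)) + A ^ (-(q / p)) * τ ^ (-q)) * (τ * R ^ N) := by
  -- This bound is equivalent to `l + 1 ≤ l * p`. It also forces `l ≠ 0`, so `θ ^ l` vanishes
  -- wherever `θ` does.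
  obtain ⟨l, hl⟩ := exists_nat_ge (p - 1)⁻¹
  have hp1 : 0 < p - 1 := hpq.sub_one_pos
  have hl : (l : ℝ) + 1 ≤ l * p := by
    rw [inv_le_iff_one_le_mul₀ hp1] at hl
    linarith
  have hl0 : l ≠ 0 := by
    rintro rfl
    norm_num at hl
  let η : ContDiffBump (0 : ℝ) := ⟨1, 2, one_pos, one_lt_two⟩
  let ψ : ContDiffBump (0 : EuclideanSpace ℝ (Fin N)) := ⟨1, 2, one_pos, one_lt_two⟩
  obtain ⟨C₁, hC₁0, hC₁⟩ := exists_fracLaplacian_le α ψ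
  obtain ⟨C₂, hC₂⟩ := ((η.contDiff (n := 1)).continuous_deriv le_rfl).bounded_above_of_compact_support
    η.hasCompactSupport.deriv
  have hC₂0 : 0 ≤ C₂ := (norm_nonneg _).trans (hC₂ 0)
  set V := volume.real (Metric.ball (0 : EuclideanSpace ℝ (Fin N)) 1)
  have hV : 0 ≤ V := measureReal_nonneg
  set c₁ := (l + 1) * C₁
  set c₂ := (l + 1) * C₂
  have hc₁ : 0 ≤ c₁ := by positivity
  have hc₂ : 0 ≤ c₂ := by positivity
  -- The factor `2 * (2 ^ N * V)` comes from the volume of the cylinder of height `2 * τ` and radius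
  -- `2 * R`, as the bumps have outer radius `2`.
  refine ⟨(c₁ ^ q + c₂ ^ q) * (2 * (2 ^ N * V)), by positivity, fun τ hτ R hR => ?_⟩
  set θ : ℝ × EuclideanSpace ℝ (Fin N) → ℝ := cutOff η ψ τ R
  have hθ₀ : ∀ z, 0 ≤ θ z := cutOff_nonneg
  have hθ₁ : ∀ z, θ z ≤ 1 := cutOff_le_one
  have htest : IsTestFunction ⊤ (fun z => θ z ^ (l + 1)) := isTestFunction_cutOff_pow hτ hR l
  have hpow := hu.integrable_pow _ htest
  refine ⟨fun z => θ z ^ (l + 1), fun z => pow_nonneg (hθ₀ z) _,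
    fun z => pow_le_one₀ (hθ₀ z) (hθ₁ z), fun z h0 h1 h2 => ?_, hpow, fun ε hε A hA => ?_⟩
  · simp only [θ]
    rw [cutOff_eq_one hτ hR, one_pow]
    · simpa [η, abs_of_pos h0] using h1
    · simpa [ψ] using h2
  have hweak := hu.weak_eq _ htest
  have htime := hu.integrable_time _ htest
  have hspace := hu.integrable_space _ htest
  rw [one_mul] at hweak
  have hinit : 0 ≤ ∫ x, u₀ x * θ (0, x) ^ (l + 1) := by
    refine integral_nonneg_of_ae ?_
    filter_upwards [hu₀_nonneg] with x hx
    exact mul_nonneg hx (pow_nonneg (hθ₀ _) _)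
  set M := ε ^ (-(q / p)) * (c₁ * R ^ (-α)) ^ q + A ^ (-(q / p)) * (c₂ * τ⁻¹) ^ q
  have hM : 0 ≤ M := by positivity
  set K := spaceTimeCylinder N (2 * τ) (2 * R)
  obtain ⟨hKfin, hKvol⟩ := volume_spaceTimeCylinder (N := N) (τ := 2 * τ) (R := 2 * R) (by positivity)
    (by positivity)
  have hKint : IntegrableOn (K.indicator fun _ => M) (slab N ⊤) := by
    refine Integrable.integrableOn ?_
    rw [integrable_indicator_iff (measurableSet_spaceTimeCylinder N _ _)]
    exact integrableOn_const hKfin.ne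
  have hmeas : MeasurableSet {z : ℝ × EuclideanSpace ℝ (Fin N) | τ ≤ z.1} :=
    measurableSet_le measurable_const measurable_fst
  -- Young is applied separately: weight `ε` for diffusion, weight `A` for the time term, which
  -- lives on `t ≥ τ`. Restricting the constants to `K` keeps them integrable.
  have hpoint : ∀ᵐ z ∂volume.restrict (slab N ⊤),
      u z * fracLaplacian α (fun y => θ (z.1, y) ^ (l + 1)) z.2
        - u z * deriv (fun s : ℝ => θ (s, z.2) ^ (l + 1)) z.1 ≤
      ε * (u z ^ p * θ z ^ (l + 1))
        + A * {z | τ ≤ z.1}.indicator (fun z => u z ^ p * θ z ^ (l + 1)) z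
        + K.indicator (fun _ => M) z := by
    filter_upwards [hu_nonneg, ae_slab_top_pos N] with z huz hz
    have huz : 0 ≤ u z := huz
    have h1 := fracLaplacian_cutOff_pow_le (η := η) (τ := τ) hα₀ hα₂ hC₁0 hC₁ hR l z
    have h2 := neg_deriv_cutOff_pow_le (R := R) (ψ := ψ) (η := η) rfl hC₂ hτ l hz
    have h3 := mul_le_mul_of_nonneg_left h1 huz
    have h4 := mul_le_mul_of_nonneg_left h2 huz
    have hup : 0 ≤ u z ^ p * θ z ^ (l + 1) := by have := hθ₀ z; positivity
    have hθK : z ∉ K → θ z = 0 := fun hzK => cutOff_eq_zero hτ hR fun h => hzK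
      ⟨⟨hz.le, (le_abs_self _).trans h.1⟩, by simpa using h.2⟩
    have h5 : u z * (c₁ * R ^ (-α) * θ z ^ l) ≤ ε * (u z ^ p * θ z ^ (l + 1))
        + K.indicator (fun _ => ε ^ (-(q / p)) * (c₁ * R ^ (-α)) ^ q) z := by
      by_cases hzK : z ∈ K
      · rw [Set.indicator_of_mem hzK]
        exact mul_mul_pow_le_young hpq hl huz (hθ₀ z) (hθ₁ z) (by positivity) hε
      · rw [Set.indicator_of_notMem hzK, hθK hzK]
        simp [hl0]
    have h6 : u z * {z : ℝ × EuclideanSpace ℝ (Fin N) | τ ≤ z.1}.indicator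
          (fun z => c₂ * τ⁻¹ * θ z ^ l) z ≤
        A * {z | τ ≤ z.1}.indicator (fun z => u z ^ p * θ z ^ (l + 1)) z
        + K.indicator (fun _ => A ^ (-(q / p)) * (c₂ * τ⁻¹) ^ q) z := by
      by_cases hzK : z ∈ K
      · rw [Set.indicator_of_mem hzK]
        by_cases hzt : z ∈ {z : ℝ × EuclideanSpace ℝ (Fin N) | τ ≤ z.1}
        · rw [Set.indicator_of_mem hzt, Set.indicator_of_mem hzt]
          exact mul_mul_pow_le_young hpq hl huz (hθ₀ z) (hθ₁ z) (by positivity) hA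
        · rw [Set.indicator_of_notMem hzt, Set.indicator_of_notMem hzt, mul_zero, mul_zero,
            zero_add]
          positivity
      · simp [Set.indicator_apply, hzK, hθK hzK, hl0]
    have h7 : K.indicator (fun _ => M) z =
        K.indicator (fun _ => ε ^ (-(q / p)) * (c₁ * R ^ (-α)) ^ q) z +
        K.indicator (fun _ => A ^ (-(q / p)) * (c₂ * τ⁻¹) ^ q) z := by
      by_cases hzK : z ∈ K <;> simp [hzK, M]
    rw [h7]
    linarith
  have hind := hpow.indicator hmeas
  have hsum : IntegrableOn (fun z => ε * (u z ^ p * θ z ^ (l + 1))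
      + A * {z | τ ≤ z.1}.indicator (fun z => u z ^ p * θ z ^ (l + 1)) z) (slab N ⊤) :=
    (hpow.const_mul ε).add (hind.const_mul A)
  have hmono := integral_mono_ae (hspace.sub htime)
    (hsum.add hKint) hpoint
  have hKle : ∫ z in slab N ⊤, K.indicator (fun _ => M) z ≤ M * (2 * τ * ((2 * R) ^ N * V)) := by
    rw [integral_indicator (measurableSet_spaceTimeCylinder N _ _), setIntegral_const, smul_eq_mul,
      mul_comm, ← hKvol]
    refine mul_le_mul_of_nonneg_left ?_ hM
    rw [measureReal_restrict_apply (measurableSet_spaceTimeCylinder N _ _)]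
    exact measureReal_mono Set.inter_subset_left hKfin.ne
  have hMeq : M * (2 * τ * ((2 * R) ^ N * V)) ≤ (c₁ ^ q + c₂ ^ q) * (2 * (2 ^ N * V)) *
      (ε ^ (-(q / p)) * R ^ (-(α * q)) + A ^ (-(q / p)) * τ ^ (-q)) * (τ * R ^ N) := by
    have e₁ : (c₁ * R ^ (-α)) ^ q = c₁ ^ q * R ^ (-(α * q)) := by
      rw [Real.mul_rpow hc₁ (by positivity), ← Real.rpow_mul hR.le, neg_mul]
    have e₂ : (c₂ * τ⁻¹) ^ q = c₂ ^ q * τ ^ (-q) := by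
      rw [Real.mul_rpow hc₂ (by positivity), Real.inv_rpow hτ.le, Real.rpow_neg hτ.le]
    have hMle : M ≤ (c₁ ^ q + c₂ ^ q) *
        (ε ^ (-(q / p)) * R ^ (-(α * q)) + A ^ (-(q / p)) * τ ^ (-q)) := by
      simp only [M, e₁, e₂]
      have t₁ : 0 ≤ c₂ ^ q * (ε ^ (-(q / p)) * R ^ (-(α * q))) := by positivity
      have t₂ : 0 ≤ c₁ ^ q * (A ^ (-(q / p)) * τ ^ (-q)) := by positivity
      linarith
    calc _ ≤ (c₁ ^ q + c₂ ^ q) *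
        (ε ^ (-(q / p)) * R ^ (-(α * q)) + A ^ (-(q / p)) * τ ^ (-q)) *
          (2 * τ * ((2 * R) ^ N * V)) := mul_le_mul_of_nonneg_right hMle (by positivity)
      _ = _ := by rw [mul_pow]; ring
  simp only [Pi.add_apply, Pi.sub_apply] at hmono
  rw [integral_sub hspace htime, integral_add hsum hKint,
    integral_add (hpow.const_mul ε) (hind.const_mul A), integral_const_mul, integral_const_mul]
    at hmono
  linarith

/-! ### Critical scaling and passage to the limit. -/

/-- The critical rescaling of the test function estimate. -/
lemma exists_critical_estimate {N : ℕ} {α : ℝ} (hα₀ : 0 < α) (hα₂ : α ≤ 2)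
    {p q : ℝ} (hpq : p.HolderConjugate q) (hαq : α * q = N + α)
    {u₀ : EuclideanSpace ℝ (Fin N) → ℝ}
    (hu₀_nonneg : 0 ≤ᵐ[volume] u₀) {u : ℝ × EuclideanSpace ℝ (Fin N) → ℝ}
    (hu : IsWeakSolution α 1 p u₀ ⊤ u) (hu_nonneg : 0 ≤ᵐ[volume.restrict (slab N ⊤)] u) :
    ∃ D, 0 ≤ D ∧ ∀ δ > 0, ∀ R > 0, ∃ φ : ℝ × EuclideanSpace ℝ (Fin N) → ℝ,
      (∀ z, 0 ≤ φ z) ∧ (∀ z, φ z ≤ 1) ∧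
      (∀ z, 0 < z.1 → z.1 ≤ δ * R ^ α → ‖z.2‖ ≤ R → φ z = 1) ∧
      IntegrableOn (fun z => u z ^ p * φ z) (slab N ⊤) ∧
      ∀ A > 0, ∫ z in slab N ⊤, u z ^ p * φ z ≤
        A * (∫ z in slab N ⊤, {z | δ * R ^ α ≤ z.1}.indicator (fun z => u z ^ p * φ z) z)
          + D * (δ + A ^ (-(q / p)) * δ ^ (1 - q)) := by
  obtain ⟨D, hD, h⟩ := exists_testFunction_estimate hα₀ hα₂ hpq hu₀_nonneg hu hu_nonneg
  refine ⟨2 * (D * (2 : ℝ) ^ (q / p)), by positivity, fun δ hδ R hR => ?_⟩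
  have hRα : 0 < R ^ α := by positivity
  obtain ⟨φ, h0, h1, h2, h3, h4⟩ := h (δ * R ^ α) (by positivity) R hR
  refine ⟨φ, h0, h1, h2, h3, fun A hA => ?_⟩
  -- With `ε = 1 / 2` half of the left side is absorbed; doubling turns `A / 2` into `A`.
  have h5 := h4 (1 / 2) (by norm_num) (A / 2) (by positivity)
  -- Criticality: `α * q = N + α` cancels every power of `R`, here and in `hscale₂`.
  have hscale₁ : R ^ (-(α * q)) * (δ * R ^ α * R ^ N) = δ := by
    have : R ^ (-(α * q)) * (R ^ α * R ^ (N : ℝ)) = 1 := by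
      rw [← Real.rpow_add hR, ← Real.rpow_add hR, hαq,
        show -((N : ℝ) + α) + (α + N) = 0 by ring, Real.rpow_zero]
    rw [Real.rpow_natCast] at this
    linear_combination δ * this
  have hscale₂ : (δ * R ^ α) ^ (-q) * (δ * R ^ α * R ^ N) = δ ^ (1 - q) := by
    have : R ^ (α * -q) * (R ^ α * R ^ (N : ℝ)) = 1 := by
      rw [← Real.rpow_add hR, ← Real.rpow_add hR, mul_neg, hαq,
        show -((N : ℝ) + α) + (α + N) = 0 by ring, Real.rpow_zero]
    rw [Real.rpow_natCast] at this
    rw [Real.mul_rpow hδ.le hRα.le, ← Real.rpow_mul hR.le, sub_eq_add_neg, Real.rpow_add hδ,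
      Real.rpow_one]
    linear_combination δ ^ (-q) * δ * this
  have hhalf : ((1 : ℝ) / 2) ^ (-(q / p)) = 2 ^ (q / p) := by
    rw [one_div, Real.inv_rpow (by norm_num), Real.rpow_neg (by norm_num), inv_inv]
  have hA2 : (A / 2) ^ (-(q / p)) = A ^ (-(q / p)) * 2 ^ (q / p) := by
    rw [div_eq_mul_inv, Real.mul_rpow hA.le (by norm_num), Real.inv_rpow (by norm_num),
      Real.rpow_neg (by norm_num : (0 : ℝ) ≤ 2), inv_inv]
  have hD' : D * ((1 / 2) ^ (-(q / p)) * R ^ (-(α * q)) +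
      (A / 2) ^ (-(q / p)) * (δ * R ^ α) ^ (-q)) * (δ * R ^ α * R ^ N) =
      D * 2 ^ (q / p) * (δ + A ^ (-(q / p)) * δ ^ (1 - q)) := by
    rw [hhalf, hA2]
    linear_combination D * 2 ^ (q / p) * hscale₁ + D * A ^ (-(q / p)) * 2 ^ (q / p) * hscale₂
  rw [hD'] at h5
  linarith

lemma ae_eq_zero_of_isWeakSolution_top {N : ℕ} {α : ℝ} (hα₀ : 0 < α) (hα₂ : α ≤ 2)
    {p q : ℝ} (hpq : p.HolderConjugate q) (hαq : α * q = N + α)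
    {u₀ : EuclideanSpace ℝ (Fin N) → ℝ}
    (hu₀_nonneg : 0 ≤ᵐ[volume] u₀) {u : ℝ × EuclideanSpace ℝ (Fin N) → ℝ}
    (hu : IsWeakSolution α 1 p u₀ ⊤ u) (hu_nonneg : 0 ≤ᵐ[volume.restrict (slab N ⊤)] u) :
    u =ᵐ[volume.restrict (slab N ⊤)] 0 := by
  obtain ⟨D, hD, h⟩ := exists_critical_estimate hα₀ hα₂ hpq hαq hu₀_nonneg hu hu_nonneg
  set μ := (volume : Measure (ℝ × EuclideanSpace ℝ (Fin N))).restrict (slab N ⊤) with hμ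
  set P : ℝ × EuclideanSpace ℝ (Fin N) → ℝ := fun z => u z ^ p with hP
  have hP₀ : 0 ≤ᵐ[μ] P := by
    filter_upwards [hu_nonneg] with z hz
    exact Real.rpow_nonneg hz p
  have hR₀ : ∀ n : ℕ, (0 : ℝ) < n + 1 := fun n => by positivity
  have hnat : Filter.Tendsto (fun n : ℕ => (n : ℝ) + 1) Filter.atTop Filter.atTop :=
    Filter.tendsto_atTop_add_const_right _ _ tendsto_natCast_atTop_atTop
  have hτlim : ∀ δ > 0, Filter.Tendsto (fun n : ℕ => δ * ((n : ℝ) + 1) ^ α)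
      Filter.atTop Filter.atTop := fun δ hδ =>
    ((tendsto_rpow_atTop hα₀).comp hnat).const_mul_atTop hδ
  have hcover : ∀ δ > 0, AECover μ Filter.atTop (fun n : ℕ =>
      {z : ℝ × EuclideanSpace ℝ (Fin N) | z.1 ≤ δ * ((n : ℝ) + 1) ^ α ∧ ‖z.2‖ ≤ n + 1}) :=
    fun δ hδ =>
    { ae_eventually_mem := .of_forall fun z =>
        ((hτlim δ hδ).eventually_ge_atTop z.1).and (hnat.eventually_ge_atTop ‖z.2‖)
      measurableSet := fun n => (measurableSet_le measurable_fst measurable_const).inter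
        (measurableSet_le measurable_snd.norm measurable_const) }
  have hcover' : ∀ δ > 0, AECover μ Filter.atTop (fun n : ℕ =>
      {z : ℝ × EuclideanSpace ℝ (Fin N) | z.1 < δ * ((n : ℝ) + 1) ^ α}) :=
    fun δ hδ =>
    { ae_eventually_mem := .of_forall fun z => (hτlim δ hδ).eventually_gt_atTop z.1
      measurableSet := fun n => measurableSet_lt measurable_fst measurable_const }
  choose! φ hφ₀ hφ₁ hφ hφi hest using h
  have hloc : ∀ δ > 0, ∀ n : ℕ, IntegrableOn P
        {z | z.1 ≤ δ * ((n : ℝ) + 1) ^ α ∧ ‖z.2‖ ≤ n + 1} μ ∧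
      ∫ z in {z | z.1 ≤ δ * ((n : ℝ) + 1) ^ α ∧ ‖z.2‖ ≤ n + 1}, P z ∂μ ≤
        ∫ z, P z * φ δ (n + 1) z ∂μ := by
    intro δ hδ n
    have hmeas := (hcover δ hδ).measurableSet n
    have hae : P =ᵐ[μ.restrict {z | z.1 ≤ δ * ((n : ℝ) + 1) ^ α ∧ ‖z.2‖ ≤ n + 1}]
        fun z => P z * φ δ (n + 1) z := by
      rw [Filter.EventuallyEq, ae_restrict_iff' hmeas]
      filter_upwards [ae_slab_top_pos N] with z hz hzm
      rw [hφ δ hδ _ (hR₀ n) z hz hzm.1 hzm.2, mul_one]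
    have hi : Integrable (fun z => P z * φ δ (n + 1) z) μ := hφi δ hδ _ (hR₀ n)
    refine ⟨hi.integrableOn.congr hae.symm, ?_⟩
    rw [integral_congr_ae hae]
    refine setIntegral_le_integral hi ?_
    filter_upwards [hP₀] with z hz
    exact mul_nonneg hz (hφ₀ δ hδ _ (hR₀ n) z)
  -- With `δ = 1` and `A = 1 / 2` the tail is at most the whole integral and is absorbed, which
  -- gives a bound uniform in `R = n + 1`.
  have hbd : ∀ n : ℕ, ∫ z in {z | z.1 ≤ 1 * ((n : ℝ) + 1) ^ α ∧ ‖z.2‖ ≤ n + 1}, P z ∂μ ≤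
      2 * (D * (1 + (1 / 2) ^ (-(q / p)) * 1 ^ (1 - q))) := by
    intro n
    have h1 := hest 1 one_pos _ (hR₀ n) (1 / 2) (by norm_num)
    have hi : Integrable (fun z => P z * φ 1 (n + 1) z) μ := hφi 1 one_pos _ (hR₀ n)
    have h2 : ∫ z, {z : ℝ × EuclideanSpace ℝ (Fin N) | 1 * ((n : ℝ) + 1) ^ α ≤ z.1}.indicator
        (fun z => P z * φ 1 (n + 1) z) z ∂μ ≤ ∫ z, P z * φ 1 (n + 1) z ∂μ := by
      refine integral_mono_ae (hi.indicator (measurableSet_le measurable_const measurable_fst)) hi ?_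
      filter_upwards [hP₀] with z hz
      exact Set.indicator_le_self' (fun _ _ => mul_nonneg hz (hφ₀ 1 one_pos _ (hR₀ n) z)) z
    have h3 := (hloc 1 one_pos n).2
    linarith
  have hPint : Integrable P μ :=
    (hcover 1 one_pos).integrable_of_integral_bounded_of_nonneg_ae _
      (fun n => (hloc 1 one_pos n).1) hP₀ (.of_forall hbd)
  -- As `R → ∞` with `δ` and `A` fixed, the integral over `t ≥ δ * R ^ α` tends to `0` because `P`
  -- is integrable.
  have hlim : ∀ δ > 0, ∀ A > 0, ∫ z, P z ∂μ ≤ D * (δ + A ^ (-(q / p)) * δ ^ (1 - q)) := by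
    intro δ hδ A hA
    have ht₁ := (hcover δ hδ).integral_tendsto_of_countably_generated hPint
    have ht₂ : Filter.Tendsto (fun n : ℕ => A * (∫ z, P z ∂μ -
        ∫ z in {z | z.1 < δ * ((n : ℝ) + 1) ^ α}, P z ∂μ)
          + D * (δ + A ^ (-(q / p)) * δ ^ (1 - q))) Filter.atTop
        (nhds (D * (δ + A ^ (-(q / p)) * δ ^ (1 - q)))) := by
      simpa using ((((hcover' δ hδ).integral_tendsto_of_countably_generated hPint).const_sub
        (∫ z, P z ∂μ)).const_mul A).add_const (D * (δ + A ^ (-(q / p)) * δ ^ (1 - q)))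
    refine le_of_tendsto_of_tendsto' ht₁ ht₂ fun n => ((hloc δ hδ n).2.trans
      (hest δ hδ _ (hR₀ n) A hA)).trans ?_
    gcongr
    have hc := integral_add_compl ((hcover' δ hδ).measurableSet n) hPint
    have hi : Integrable (fun z => P z * φ δ (n + 1) z) μ := hφi δ hδ _ (hR₀ n)
    have hm : MeasurableSet
        {z : ℝ × EuclideanSpace ℝ (Fin N) | δ * ((n : ℝ) + 1) ^ α ≤ z.1} :=
      measurableSet_le measurable_const measurable_fst
    have hcompl : {z : ℝ × EuclideanSpace ℝ (Fin N) | z.1 < δ * ((n : ℝ) + 1) ^ α}ᶜ =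
        {z | δ * ((n : ℝ) + 1) ^ α ≤ z.1} := by
      ext z; simp
    rw [hcompl] at hc
    have : ∫ z, {z : ℝ × EuclideanSpace ℝ (Fin N) | δ * ((n : ℝ) + 1) ^ α ≤ z.1}.indicator
        (fun z => P z * φ δ (n + 1) z) z ∂μ ≤
        ∫ z in {z | δ * ((n : ℝ) + 1) ^ α ≤ z.1}, P z ∂μ := by
      rw [integral_indicator hm]
      refine integral_mono_ae hi.integrableOn hPint.integrableOn (ae_restrict_of_ae ?_)
      filter_upwards [hP₀] with z hz
      exact mul_le_of_le_one_right hz (hφ₁ δ hδ _ (hR₀ n) z)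
    linarith
  have hqp : 0 < q / p := div_pos hpq.symm.pos hpq.pos
  -- `A → ∞` must precede `δ → 0`, since `δ ^ (1 - q)` blows up at `0`.
  have hlim' : ∀ δ > 0, ∫ z, P z ∂μ ≤ D * δ := by
    intro δ hδ
    have ht : Filter.Tendsto (fun A : ℝ => D * (δ + A ^ (-(q / p)) * δ ^ (1 - q))) Filter.atTop
        (nhds (D * δ)) := by
      simpa using (((tendsto_rpow_neg_atTop hqp).mul_const (δ ^ (1 - q))).const_add δ).const_mul D
    exact ge_of_tendsto ht ((Filter.eventually_gt_atTop 0).mono fun A hA => hlim δ hδ A hA)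
  have hzero : ∫ z, P z ∂μ ≤ 0 := by
    have ht : Filter.Tendsto (fun δ : ℝ => D * δ) (nhdsWithin 0 (Set.Ioi 0)) (nhds 0) := by
      have : Filter.Tendsto (fun δ : ℝ => D * δ) (nhds 0) (nhds (D * 0)) :=
        (continuous_const.mul continuous_id).tendsto 0
      rw [mul_zero] at this
      exact this.mono_left nhdsWithin_le_nhds
    exact ge_of_tendsto ht (by filter_upwards [self_mem_nhdsWithin] with δ hδ using hlim' δ hδ)
  have hPz := (integral_eq_zero_iff_of_nonneg_ae hP₀ hPint).1
    (le_antisymm hzero (integral_nonneg_of_ae hP₀))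
  filter_upwards [hPz, hu_nonneg] with z hz huz
  exact (Real.rpow_eq_zero huz hpq.pos.ne').1 hz

/-- Every nonnegative nonzero weak solution of `∂ₜ u = -Λ^α u + u ^ (1 + α / N)` with nonnegative
integrable initial datum has a finite existence time: no such solution is global. -/
theorem theorem3 (N : ℕ) (hN : 1 ≤ N) (α : ℝ) (hα₀ : 0 < α) (hα₂ : α ≤ 2)
    (p : ℝ) (hp : p = 1 + α / (N : ℝ))
    (u₀ : EuclideanSpace ℝ (Fin N) → ℝ) (hu₀ : Integrable u₀) (hu₀_nonneg : 0 ≤ᵐ[volume] u₀)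
    (T : ℝ≥0∞) (u : ℝ × EuclideanSpace ℝ (Fin N) → ℝ)
    (hu : IsWeakSolution α 1 p u₀ T u)
    (hu_nonneg : 0 ≤ᵐ[volume.restrict (slab N T)] u)
    (hu_ne : ¬ u =ᵐ[volume.restrict (slab N T)] 0) :
    T < ⊤ := by
  rw [lt_top_iff_ne_top]
  rintro rfl
  have hN0 : (0 : ℝ) < N := by exact_mod_cast hN
  have hpq : p.HolderConjugate (p / (p - 1)) :=
    Real.HolderConjugate.conjExponent (by rw [hp]; linarith [div_pos hα₀ hN0])
  refine hu_ne (ae_eq_zero_of_isWeakSolution_top hα₀ hα₂ hpq ?_ hu₀_nonneg hu hu_nonneg)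
  -- Since `p - 1 = α / N`, the conjugate exponent `q = p / (p - 1)` satisfies `α * q = N * p = N +
  -- α`.
  rw [hp, add_sub_cancel_left]
  field_simp
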